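/- Let $A=(A_i)_{i\in I}$ be a finite cover, that is, a family of sets indexed by a finite set $I$. The nerve $N(A)$ is the simplicial complex whose simplices are the nonempty sets $\sigma\subset I$ with $A_\sigma:=\bigcap_{i\in\sigma}A_i\neq\varnothing$; it is identified with its face poset, ordered by inclusion. Let $P\subset N(A)$ be a subposet, and let $N(A^P)$ be the nerve of the family $A^P=(A_\sigma)_{\sigma\in P}$, indexed by $P$. For a finite poset $Q$, let $\Delta(Q)$ be its order complex, whose simplices are the nonempty chains of $Q$; an order-preserving map $f\colon Q\to Q'$ induces a simplicial map $\Delta(f)\colon\Delta(Q)\to\Delta(Q')$ by applying $f$ to vertices. Suppose that $\sigma_1\cup\dots\cup\sigma_m\in P$ for every simplex $\{\sigma_1,\dots,\sigma_m\}\in N(A^P)$. Then $F(\{\sigma_1,\dots,\sigma_m\})=\sigma_1\cup\dots\cup\sigma_m$ defines an order-preserving map $F\colon N(A^P)\to P$, and $\Delta(F)\colon\Delta(N(A^P))\to\Delta(P)$ induces a homotopy equivalence of geometric realizations. -/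

import Mathlib

namespace SubposetNerve

/-! ### Finite simplicial complexes and their geometric realizations -/

/-- The geometric realization of a simplicial complex with finitely many vertices: the points are
the families of barycentric coordinates (nonnegative, with sum `1`) supported on some face. As a
set of functions `V → ℝ` it carries the subspace topology of the product topology; since `V` is
finite, this is the usual topology of the realization. -/
def realization {V : Type*} [Finite V] (K : PreAbstractSimplicialComplex V) : Set (V → ℝ) :=
  {x | (∀ v, 0 ≤ x v) ∧ ∃ s ∈ K.faces, (∀ v, v ∉ s → x v = 0) ∧ ∑ v ∈ s, x v = 1}

/-- A simplicial map: a map of vertices for which the image of every face is a face. -/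
structure SimplicialMap {V W : Type*} (K : PreAbstractSimplicialComplex V)
    (L : PreAbstractSimplicialComplex W) where
  toFun : V → W
  map_faces : ∀ s ∈ K.faces, ∃ t ∈ L.faces, (t : Set W) = toFun '' (s : Set V)

/-- The affine extension of a map of vertices to barycentric coordinates: the coordinate of the
image at `w` is the sum of the coordinates at the vertices that are sent to `w`. -/
noncomputable def pushCoord {V W : Type*} (f : V → W) (x : V → ℝ) : W → ℝ :=
  fun w => ∑ᶠ v ∈ f ⁻¹' {w}, x v

theorem pushCoord_mem {V W : Type*} [Finite V] [Finite W] {K : PreAbstractSimplicialComplex V}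
    {L : PreAbstractSimplicialComplex W} (f : SimplicialMap K L) {x : V → ℝ}
    (hx : x ∈ realization K) : pushCoord f.toFun x ∈ realization L := by
  classical
  obtain ⟨h0, s, hs, hsupp, hsum⟩ := hx
  obtain ⟨t, ht, hts⟩ := f.map_faces s hs
  have hpush : ∀ w, pushCoord f.toFun x w = ∑ v ∈ s with f.toFun v = w, x v := by
    intro w
    refine finsum_mem_eq_sum_of_inter_support_eq _ ?_
    ext v
    simp only [Set.mem_inter_iff, Set.mem_preimage, Set.mem_singleton_iff, Function.mem_support,
      Finset.coe_filter, Set.mem_ofPred_eq]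
    constructor
    · rintro ⟨h1, h2⟩
      exact ⟨⟨by_contra fun h => h2 (hsupp v h), h1⟩, h2⟩
    · rintro ⟨⟨_, h1⟩, h2⟩
      exact ⟨h1, h2⟩
  refine ⟨fun w => ?_, t, ht, fun w hw => ?_, ?_⟩
  · rw [hpush]
    exact Finset.sum_nonneg fun v _ => h0 v
  · rw [hpush]
    refine Finset.sum_eq_zero fun v hv => ?_
    obtain ⟨hvs, rfl⟩ := Finset.mem_filter.1 hv
    refine absurd ?_ hw
    rw [← Finset.mem_coe, hts]
    exact ⟨v, Finset.mem_coe.2 hvs, rfl⟩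
  · simp only [hpush]
    rw [← hsum]
    refine Finset.sum_fiberwise_of_maps_to (fun v hv => ?_) x
    rw [← Finset.mem_coe, hts]
    exact ⟨v, hv, rfl⟩

theorem continuous_pushCoord {V W : Type*} [Finite V] (f : V → W) :
    Continuous (pushCoord f) := by
  classical
  have := Fintype.ofFinite V
  refine continuous_pi fun w => ?_
  have : (fun x : V → ℝ => pushCoord f x w) = fun x => ∑ v with f v = w, x v := by
    funext x
    exact finsum_mem_eq_sum_of_inter_support_eq _ (by ext v; simp)
  rw [this]
  fun_prop

/-- The continuous map of realizations induced by a simplicial map. -/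
noncomputable def SimplicialMap.realize {V W : Type*} [Finite V] [Finite W]
    {K : PreAbstractSimplicialComplex V} {L : PreAbstractSimplicialComplex W}
    (f : SimplicialMap K L) : C(realization K, realization L) where
  toFun x := ⟨pushCoord f.toFun x.1, pushCoord_mem f x.2⟩
  continuous_toFun :=
    ((continuous_pushCoord f.toFun).comp continuous_subtype_val).subtype_mk _

/-! ### Order complexes -/

/-- The order complex of a poset: its vertices are the elements of `P`, and its faces are the
nonempty finite chains. -/
def orderComplex (P : Type*) [PartialOrder P] : PreAbstractSimplicialComplex P where
  faces := {s | s.Nonempty ∧ IsChain (· ≤ ·) (s : Set P)}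
  isRelLowerSet_faces := fun _ hs =>
    ⟨hs.1, fun _ hts ht => ⟨ht, hs.2.mono (Finset.coe_subset.2 hts)⟩⟩

/-- The simplicial map of order complexes induced by an order-preserving map. -/
def orderComplexMap {P Q : Type*} [PartialOrder P] [PartialOrder Q] (f : P →o Q) :
    SimplicialMap (orderComplex P) (orderComplex Q) where
  toFun := f
  map_faces s hs := by
    classical
    refine ⟨s.image f, ⟨hs.1.image f, ?_⟩, Finset.coe_image⟩
    rw [Finset.coe_image]
    exact hs.2.image_of_map_rel _ _ _ (fun _ _ h => f.monotone h)

/-! ### Nerves -/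

/-- The nerve of a family of sets: the faces are the nonempty finite sets of indices for which
the sets of the family have a common point. The face poset of the nerve is its set of faces,
ordered by inclusion. -/
def nerve {X I : Type*} (A : I → Set X) : PreAbstractSimplicialComplex I where
  faces := {s | s.Nonempty ∧ (⋂ i ∈ s, A i).Nonempty}
  isRelLowerSet_faces := fun _ hs =>
    ⟨hs.1, fun _ hts ht => ⟨ht, hs.2.mono (Set.biInter_subset_biInter_left hts)⟩⟩

/-- The family `(A_σ)_{σ ∈ P}` with `A_σ = ⋂_{i ∈ σ} A_i`, indexed by a set `P` of finite sets of
indices. -/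
def inducedCover {X I : Type*} (A : I → Set X) (P : Set (Finset I)) : P → Set X :=
  fun σ => ⋂ i ∈ σ.1, A i

/-! ### Homotopy equivalences -/

/-- A continuous map is a homotopy equivalence if it has an inverse up to homotopy. -/
def IsHomotopyEquivalence {X Y : Type*} [TopologicalSpace X] [TopologicalSpace Y]
    (f : C(X, Y)) : Prop :=
  ∃ g : C(Y, X), (g.comp f).Homotopic (ContinuousMap.id X) ∧
    (f.comp g).Homotopic (ContinuousMap.id Y)

end SubposetNerve

namespace SubposetNerve

/-! ### The coordinates of an induced map -/

/-! The union map `F` has a right adjoint `G σ = {τ ∈ P | τ ⊆ σ}`: a union lies in `σ` iff each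
member does. Thus `id ≤ G ∘ F` and `F ∘ G ≤ id`, so it suffices that comparable monotone maps induce
homotopic maps (`homotopic_orderComplexMap_of_le`). For this, one map is turned into the other one
rank at a time; consecutive maps are contiguous, and contiguous maps are joined by straight
segments. -/

theorem pushCoord_apply {V W : Type*} [Fintype V] [DecidableEq W] (f : V → W) (x : V → ℝ)
    (w : W) : pushCoord f x w = ∑ v with f v = w, x v :=
  finsum_mem_eq_sum_of_inter_support_eq _ (by ext v; simp)

theorem pushCoord_id {V : Type*} (x : V → ℝ) : pushCoord id x = x := by
  funext w
  simp [pushCoord]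

theorem pushCoord_comp {U V W : Type*} [Finite U] [Finite V] (g : V → W) (f : U → V)
    (x : U → ℝ) : pushCoord g (pushCoord f x) = pushCoord (g ∘ f) x := by
  classical
  have := Fintype.ofFinite U
  have := Fintype.ofFinite V
  funext w
  simp only [pushCoord_apply, Function.comp_apply]
  rw [← Finset.sum_fiberwise_of_maps_to (s := {u | g (f u) = w}) (t := {v | g v = w}) (g := f)
    (by simp)]
  refine Finset.sum_congr rfl fun v hv => Finset.sum_congr ?_ fun _ _ => rfl
  ext u
  simp only [Finset.mem_filter, Finset.mem_univ, true_and] at hv ⊢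
  exact ⟨fun h => ⟨h ▸ hv, h⟩, And.right⟩

theorem pushCoord_eq_zero {V W : Type*} {f : V → W} {x : V → ℝ} {s : Finset V}
    (hx : ∀ v ∉ s, x v = 0) {w : W} (hw : w ∉ f '' (s : Set V)) : pushCoord f x w = 0 := by
  refine finsum_mem_of_eqOn_zero fun v hv => ?_
  exact hx v fun hvs => hw ⟨v, hvs, hv⟩

/-- Summing over all vertices frees the normalization from the chosen face, so points with different
carriers can be averaged. -/
theorem mem_realization_iff {V : Type*} [Fintype V] {K : PreAbstractSimplicialComplex V}
    {x : V → ℝ} : x ∈ realization K ↔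
      (∀ v, 0 ≤ x v) ∧ ∑ v, x v = 1 ∧ ∃ s ∈ K.faces, ∀ v ∉ s, x v = 0 := by
  constructor
  · rintro ⟨h0, s, hs, hz, h1⟩
    exact ⟨h0, by rw [← h1, Finset.sum_subset s.subset_univ fun v _ => hz v], s, hs, hz⟩
  · rintro ⟨h0, h1, s, hs, hz⟩
    exact ⟨h0, s, hs, hz, by rw [← h1, Finset.sum_subset s.subset_univ fun v _ => hz v]⟩

/-! ### Contiguous simplicial maps are homotopic -/

/-- Simplicial maps are contiguous if they send every face into a common face. -/
def Contiguous {V W : Type*} {K : PreAbstractSimplicialComplex V}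
    {L : PreAbstractSimplicialComplex W} (f g : SimplicialMap K L) : Prop :=
  ∀ s ∈ K.faces, ∃ t ∈ L.faces, f.toFun '' (s : Set V) ∪ g.toFun '' (s : Set V) ⊆ t

theorem Contiguous.lineMap_mem {V W : Type*} [Finite V] [Finite W]
    {K : PreAbstractSimplicialComplex V} {L : PreAbstractSimplicialComplex W}
    {f g : SimplicialMap K L} (h : Contiguous f g) (t : unitInterval) (x : realization K) :
    (1 - (t : ℝ)) • pushCoord f.toFun x.1 + (t : ℝ) • pushCoord g.toFun x.1
      ∈ realization L := by
  have := Fintype.ofFinite V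
  have := Fintype.ofFinite W
  obtain ⟨f0, f1, -⟩ := mem_realization_iff.1 (pushCoord_mem f x.2)
  obtain ⟨g0, g1, -⟩ := mem_realization_iff.1 (pushCoord_mem g x.2)
  obtain ⟨-, -, s, hs, hz⟩ := mem_realization_iff.1 x.2
  obtain ⟨r, hr, hsub⟩ := h s hs
  refine mem_realization_iff.2 ⟨fun w => ?_, ?_, r, hr, fun w hw => ?_⟩
  · exact add_nonneg (mul_nonneg (sub_nonneg.2 t.2.2) (f0 w)) (mul_nonneg t.2.1 (g0 w))
  · simp only [Pi.add_apply, Pi.smul_apply, smul_eq_mul, Finset.sum_add_distrib,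
      ← Finset.mul_sum, f1, g1]
    ring
  · have hf := pushCoord_eq_zero hz fun h' => hw (hsub (Or.inl h'))
    have hg := pushCoord_eq_zero hz fun h' => hw (hsub (Or.inr h'))
    simp [hf, hg]

theorem Contiguous.homotopic {V W : Type*} [Finite V] [Finite W]
    {K : PreAbstractSimplicialComplex V} {L : PreAbstractSimplicialComplex W}
    {f g : SimplicialMap K L} (h : Contiguous f g) : f.realize.Homotopic g.realize := by
  have hf := continuous_pushCoord f.toFun
  have hg := continuous_pushCoord g.toFun
  refine ⟨⟨⟨fun p => ⟨_, h.lineMap_mem p.1 p.2⟩, Continuous.subtype_mk (by fun_prop) _⟩,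
    fun x => ?_, fun x => ?_⟩⟩
  · exact Subtype.ext (by simp [SimplicialMap.realize])
  · exact Subtype.ext (by simp [SimplicialMap.realize])

/-! ### Comparable order-preserving maps induce homotopic maps -/

/-- The order-preserving map that agrees with `g` on the elements of rank at least `n` and with
the smaller map `f` on the others. -/
noncomputable def spliceHom {P Q : Type*} [PartialOrder P] [PartialOrder Q] {f g : P →o Q}
    (hfg : f ≤ g) {r : P → ℕ} (hr : StrictMono r) (n : ℕ) : P →o Q where
  toFun p := if n ≤ r p then g p else f p
  monotone' p q hpq := by
    have := hr.monotone hpq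
    dsimp only
    split_ifs with h1 h2 h2
    · exact g.monotone hpq
    · omega
    · exact (f.monotone hpq).trans (hfg q)
    · exact f.monotone hpq

theorem spliceHom_apply {P Q : Type*} [PartialOrder P] [PartialOrder Q] {f g : P →o Q}
    (hfg : f ≤ g) {r : P → ℕ} (hr : StrictMono r) (n : ℕ) (p : P) :
    spliceHom hfg hr n p = if n ≤ r p then g p else f p := rfl

/-- The two maps can differ only at elements of rank exactly `n`, and a chain contains at most one
of these. -/
theorem contiguous_spliceHom {P Q : Type*} [PartialOrder P] [PartialOrder Q] {f g : P →o Q}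
    (hfg : f ≤ g) {r : P → ℕ} (hr : StrictMono r) (n : ℕ) :
    Contiguous (orderComplexMap (spliceHom hfg hr n))
      (orderComplexMap (spliceHom hfg hr (n + 1))) := by
  classical
  rintro s ⟨hne, hs⟩
  refine ⟨s.image (spliceHom hfg hr n) ∪ s.image (spliceHom hfg hr (n + 1)),
    ⟨(hne.image _).mono Finset.subset_union_left, ?_⟩, by simp [orderComplexMap]⟩
  have key : ∀ p ∈ s, ∀ q ∈ s, spliceHom hfg hr n p ≤ spliceHom hfg hr (n + 1) q ∨
      spliceHom hfg hr (n + 1) q ≤ spliceHom hfg hr n p := by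
    intro p hp q hq
    have hle : ∀ p, spliceHom hfg hr (n + 1) p ≤ spliceHom hfg hr n p := fun p => by
      have := hfg p
      simp only [spliceHom_apply]
      split_ifs <;> first | exact le_rfl | exact this | omega
    rcases hs.total hp hq with hpq | hqp
    · rcases hpq.eq_or_lt with rfl | hlt
      · exact Or.inr (hle p)
      -- Comparing `g p` with `f q` would require `n ≤ r p < r q ≤ n`, so that case never occurs.
      · have h1 := hr hlt
        have h2 := hfg q
        have h3 := f.monotone hpq
        have h4 := g.monotone hpq
        left
        simp only [spliceHom_apply]
        split_ifs <;> first | exact h4 | exact h3 | exact h3.trans h2 | omega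
    · exact Or.inr ((hle q).trans ((spliceHom hfg hr n).monotone hqp))
  rw [Finset.coe_union, Finset.coe_image, Finset.coe_image]
  rintro _ (⟨p, hp, rfl⟩ | ⟨p, hp, rfl⟩) _ (⟨q, hq, rfl⟩ | ⟨q, hq, rfl⟩) -
  · exact (hs.total hp hq).imp (fun h => (spliceHom hfg hr n).monotone h)
      fun h => (spliceHom hfg hr n).monotone h
  · exact key p hp q hq
  · exact (key q hq p hp).symm
  · exact (hs.total hp hq).imp (fun h => (spliceHom hfg hr (n + 1)).monotone h)
      fun h => (spliceHom hfg hr (n + 1)).monotone h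

theorem homotopic_orderComplexMap_of_le {P Q : Type*} [PartialOrder P] [PartialOrder Q] [Finite P]
    [Finite Q] {f g : P →o Q} (hfg : f ≤ g) :
    (orderComplexMap f).realize.Homotopic (orderComplexMap g).realize := by
  -- The size of the down-set is a strictly monotone rank bounded by `Nat.card P`, so threshold
  -- `Nat.card P + 1` leaves only `f`, while threshold `0` gives `g`.
  let r : P → ℕ := fun p => (Set.Iic p).ncard
  have hr : StrictMono r := fun p q hpq => Set.ncard_lt_ncard (Set.Iic_ssubset_Iic.2 hpq)
  have hchain : ∀ n, (orderComplexMap (spliceHom hfg hr n)).realize.Homotopic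
      (orderComplexMap g).realize := by
    intro n
    induction n with
    | zero =>
      have : spliceHom hfg hr 0 = g := by ext p; simp [spliceHom_apply]
      rw [this]
    | succ n ih => exact (contiguous_spliceHom hfg hr n).homotopic.symm.trans ih
  have hlast : spliceHom hfg hr (Nat.card P + 1) = f := by
    ext p
    have : r p ≤ Nat.card P := Set.ncard_le_card _
    simp only [spliceHom_apply]
    rw [if_neg (by omega)]
  have := hchain (Nat.card P + 1)
  rwa [hlast] at this

theorem realize_orderComplexMap_comp {P Q R : Type*} [PartialOrder P] [PartialOrder Q]
    [PartialOrder R] [Finite P] [Finite Q] [Finite R] (g : Q →o R) (f : P →o Q) :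
    (orderComplexMap g).realize.comp (orderComplexMap f).realize =
      (orderComplexMap (g.comp f)).realize :=
  ContinuousMap.ext fun x => Subtype.ext (pushCoord_comp g f x.1)

theorem realize_orderComplexMap_id {P : Type*} [PartialOrder P] [Finite P] :
    (orderComplexMap (OrderHom.id : P →o P)).realize = ContinuousMap.id _ :=
  ContinuousMap.ext fun x => Subtype.ext (pushCoord_id x.1)

theorem isHomotopyEquivalence_of_galoisConnection {P Q : Type*} [PartialOrder P] [PartialOrder Q]
    [Finite P] [Finite Q] {f : P →o Q} {g : Q →o P} (h : GaloisConnection f g) :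
    IsHomotopyEquivalence (orderComplexMap f).realize := by
  refine ⟨(orderComplexMap g).realize, ?_, ?_⟩
  · rw [realize_orderComplexMap_comp, ← realize_orderComplexMap_id]
    exact (homotopic_orderComplexMap_of_le fun p => h.le_u_l p).symm
  · rw [realize_orderComplexMap_comp, ← realize_orderComplexMap_id]
    exact homotopic_orderComplexMap_of_le fun q => h.l_u_le q

/-! ### The union map and its adjoint -/

/-- The union of the indices of a face of the nerve of the induced cover. -/
def unionHom {X I : Type*} [DecidableEq I] (A : I → Set X) (P : Set (Finset I))
    (hunion : ∀ S ∈ (nerve (inducedCover A P)).faces, S.biUnion (fun σ => σ.1) ∈ P) :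
    (nerve (inducedCover A P)).faces →o P where
  toFun S := ⟨S.1.biUnion (fun σ => σ.1), hunion S.1 S.2⟩
  monotone' _ _ h := Finset.biUnion_subset_biUnion_of_subset_left _ h

/-- The face of the nerve of the induced cover consisting of all `τ ∈ P` below a given `σ ∈ P`. -/
noncomputable def lowerFaceHom {X I : Type*} [Finite I] (A : I → Set X) (P : Set (Finset I))
    (hP : P ⊆ (nerve A).faces) : P →o (nerve (inducedCover A P)).faces where
  toFun σ := ⟨(Set.toFinite (Set.Iic σ)).toFinset, ⟨σ, by simp⟩, by
    -- A point of `A_σ` exists because `σ` is a face of the nerve; it lies in `A_τ` for every `τ ⊆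
    -- σ`.
    refine (hP σ.2).2.mono (Set.subset_iInter₂ fun τ hτ => ?_)
    exact Set.biInter_subset_biInter_left (by simpa using hτ)⟩
  monotone' _ _ h := Set.Finite.toFinset_subset_toFinset.2 (Set.Iic_subset_Iic.2 h)

theorem galoisConnection_unionHom_lowerFaceHom {X I : Type*} [Finite I] [DecidableEq I]
    (A : I → Set X) (P : Set (Finset I)) (hP : P ⊆ (nerve A).faces)
    (hunion : ∀ S ∈ (nerve (inducedCover A P)).faces, S.biUnion (fun σ => σ.1) ∈ P) :
    GaloisConnection (unionHom A P hunion) (lowerFaceHom A P hP) := by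
  intro S σ
  change S.1.biUnion (fun σ => σ.1) ⊆ σ.1 ↔ S.1 ⊆ (Set.toFinite (Set.Iic σ)).toFinset
  rw [Finset.biUnion_subset]
  refine forall₂_congr fun τ _ => ?_
  rw [Set.Finite.mem_toFinset]
  rfl

end SubposetNerve

theorem mainTheorem6 {X I : Type*} [Finite I] [DecidableEq I] (A : I → Set X)
    (P : Set (Finset I)) (hP : P ⊆ (SubposetNerve.nerve A).faces)
    (hunion : ∀ S ∈ (SubposetNerve.nerve (SubposetNerve.inducedCover A P)).faces,
      S.biUnion (fun σ => σ.1) ∈ P) :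
    ∃ F : (SubposetNerve.nerve (SubposetNerve.inducedCover A P)).faces →o P,
      (∀ S, (F S : Finset I) = S.1.biUnion (fun σ => σ.1)) ∧
      SubposetNerve.IsHomotopyEquivalence (SubposetNerve.orderComplexMap F).realize :=
  ⟨SubposetNerve.unionHom A P hunion, fun _ => rfl,
    SubposetNerve.isHomotopyEquivalence_of_galoisConnection
      (SubposetNerve.galoisConnection_unionHom_lowerFaceHom A P hP hunion)⟩
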